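/- **Conventions.** A *manifold* is a second countable Hausdorff smooth manifold with corners; $TM$ is its tangent bundle and $\tau$ the bundle projection. A *hybrid phase space* $a$ consists of a small category $S^a$, a manifold $a(s)$ for each object $s$, and a relation $a(\gamma)\subseteq a(s)\times a(t)$ for each arrow $\gamma:s\to t$, such that $a(\mathrm{id}_s)$ is the diagonal and $a(\delta\circ\gamma)$ is the composite relation $\{(x,z):\exists y,\ (x,y)\in a(\gamma),\ (y,z)\in a(\delta)\}$. A *morphism* $f:a\to b$ is a functor $\varphi:S^a\to S^b$ with smooth maps $f_s:a(s)\to b(\varphi(s))$ such that $(f_s\times f_t)(a(\gamma))\subseteq b(\varphi(\gamma))$ for every $\gamma:s\to t$. These form a category $\mathsf{HyPh}$. Put $\mathbb U a=\bigsqcup_s a(s)$, with the induced maps $\mathbb U f$ and $T\mathbb U f$. Finite products in $\mathsf{HyPh}$ are formed componentwise, and $\mathbb U(\prod_x a_x)\cong\prod_x\mathbb U a_x$, $T\mathbb U(\prod_x a_x)\cong\prod_x T\mathbb U a_x$ canonically. A *hybrid surjective submersion* $a$ is a morphism $p_a:a_{tot}\to a_{st}$ of hybrid phase spaces such that $\mathbb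 U p_a$ is a surjective submersion. A morphism $f:a\to b$ is a pair $(f_{tot}:a_{tot}\to b_{tot},\ f_{st}:a_{st}\to b_{st})$ of morphisms of hybrid phase spaces with $p_b f_{tot}=f_{st}p_a$. These form the category $\mathsf{HySSub}$, with finite products computed on $tot$ and on $st$. The morphism $f$ is an *interconnection* if $f_{st}$ is an isomorphism in $\mathsf{HyPh}$. For $a\in\mathsf{HySSub}$, let $\mathrm{dCrl}(a)$ be the set of pairs $(X,\rho)$ where $X:\mathbb U a_{tot}\to T\mathbb U a_{st}$ is smooth with $\tau\circ X=\mathbb U p_a$, and $\rho:\mathbb U a_{tot}\to\mathbb U a_{st}$ is a map of sets such that for each $x$ there is an arrow $\gamma_x$ of $S^{a_{st}}$ with $(\mathbb U p_a(x),\rho(x))\in a_{st}(\gamma_x)$. For $f:a\to b$, the elements $(X,\rho)\in\mathrm{dCrl}(a)$ and $(Y,\sigma)\in\mathrm{dCrl}(b)$ are *$f$-related* if $T\mathbb U f_{st}\circ X=Y\circ\mathbb U f_{tot}$ and $\mathbb U f_{st}\circ\rho=\sigma\circ\mathbb U f_{tot}$; the relation $\mathrm{dCrl}(f)\subseteq\mathrm{dCrl}(a)\times\mathrm{dCrl}(b)$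 is the set of $f$-related pairs. For an interconnection $i:a\to b$ and $(Y,\sigma)\in\mathrm{dCrl}(b)$ put $$\mathrm{dCrl}(i)(Y,\sigma)=\big((T\mathbb U i_{st})^{-1}\circ Y\circ\mathbb U i_{tot},\ (\mathbb U i_{st})^{-1}\circ\sigma\circ\mathbb U i_{tot}\big).$$ For a finite family $(a_x)_{x\in X}$ in $\mathsf{HySSub}$ and $(X_x,\rho_x)\in\mathrm{dCrl}(a_x)$, let $\mathscr P_X\big((X_x,\rho_x)_x\big)$ be the pair of maps which, under the canonical identifications above, sends $(z_x)_x$ to $\big((X_x(z_x))_x,\ (\rho_x(z_x))_x\big)$. A *network* $(\mathcal H_X,i_a)$ is a finite set $X$, a family $(\mathcal H_{X,x})_{x\in X}$ in $\mathsf{HySSub}$ and an interconnection $i_a:a\to\prod_{x}\mathcal H_{X,x}$. A *morphism of networks* $((\varphi,\Phi),z):(\mathcal H_X,i_a)\to(\mathcal H_Y,i_b)$ is a map $\varphi:X\to Y$, morphisms $\Phi_x:\mathcal H_{Y,\varphi(x)}\to\mathcal H_{X,x}$ in $\mathsf{HySSub}$ for $x\in X$, and a morphism $z:b\to a$ in $\mathsf{HySSub}$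 such that $\Pi(\varphi,\Phi)\circ i_b=i_a\circ z$, where $\Pi(\varphi,\Phi):\prod_y\mathcal H_{Y,y}\to\prod_x\mathcal H_{X,x}$ is the morphism whose $x$-component is $\Phi_x\circ\mathrm{pr}_{\varphi(x)}$. In the double category $\mathsf{Set}^{\square}$ (sets, functions, relations), functions $f:A\to C$, $g:B\to D$ and relations $R\subseteq A\times B$, $S\subseteq C\times D$ form a *1-morphism* from $R$ to $S$ if $(f\times g)(R)\subseteq S$. **Theorem.** Let $((\varphi,\Phi),z):(\mathcal H_X,i_a)\to(\mathcal H_Y,i_b)$ be a morphism of networks. Then $\mathscr P_X:\prod_x\mathrm{dCrl}(\mathcal H_{X,x})\to\mathrm{dCrl}(\prod_x\mathcal H_{X,x})$, $\mathscr P_Y:\prod_y\mathrm{dCrl}(\mathcal H_{Y,y})\to\mathrm{dCrl}(\prod_y\mathcal H_{Y,y})$, $\mathrm{dCrl}(i_a):\mathrm{dCrl}(\prod_x\mathcal H_{X,x})\to\mathrm{dCrl}(a)$ and $\mathrm{dCrl}(i_b):\mathrm{dCrl}(\prod_y\mathcal H_{Y,y})\to\mathrm{dCrl}(b)$ are well-defined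 maps, and the functions $\mathrm{dCrl}(i_b)\circ\mathscr P_Y$ and $\mathrm{dCrl}(i_a)\circ\mathscr P_X$ form a 1-morphism in $\mathsf{Set}^\square$ from the relation $$\mathrm{dCrl}(\varphi,\Phi)=\Big\{\big((w_y)_y,(v_x)_x\big)\in\prod_y\mathrm{dCrl}(\mathcal H_{Y,y})\times\prod_x\mathrm{dCrl}(\mathcal H_{X,x}):\ (w_{\varphi(x)},v_x)\in\mathrm{dCrl}(\Phi_x)\ \text{for all }x\in X\Big\}$$ to the relation $\mathrm{dCrl}(z)\subseteq\mathrm{dCrl}(b)\times\mathrm{dCrl}(a)$. That is, whenever $(w_{\varphi(x)},v_x)$ is $\Phi_x$-related for every $x\in X$, the pair $$\Big(\mathrm{dCrl}(i_b)\big(\mathscr P_Y((w_y)_y)\big),\ \mathrm{dCrl}(i_a)\big(\mathscr P_X((v_x)_x)\big)\Big)$$ is $z$-related. -/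

import Mathlib

open CategoryTheory
open scoped Manifold ContDiff Topology

universe u

noncomputable section

/-! ### Finite products of manifolds with corners -/

section PiManifold

variable {ι : Type u} [Fintype ι] {E : ι → Type u} [∀ i, NormedAddCommGroup (E i)]
  [∀ i, NormedSpace ℝ (E i)] {H : ι → Type u} [∀ i, TopologicalSpace (H i)]
  {I : ∀ i, ModelWithCorners ℝ (E i) (H i)} {M : ι → Type u} [∀ i, TopologicalSpace (M i)]
  [∀ i, ChartedSpace (H i) (M i)]
  {E' : Type u} [NormedAddCommGroup E'] [NormedSpace ℝ E'] {H' : Type u} [TopologicalSpace H']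
  {J : ModelWithCorners ℝ E' H'} {N : Type u} [TopologicalSpace N] [ChartedSpace H' N]

theorem isManifold_pi [∀ i, IsManifold (I i) ∞ (M i)] :
    IsManifold (ModelWithCorners.pi I) ∞ (∀ i, M i) := by
  apply isManifold_of_contDiffOn
  rintro _ _ ⟨e, he, rfl⟩ ⟨e', he', rfl⟩
  rw [contDiffOn_pi]
  intro i
  have h := ((contDiffGroupoid ∞ (I i)).compatible (he i (Set.mem_univ i))
    (he' i (Set.mem_univ i))).1
  refine ContDiffOn.comp (g := I i ∘ (e i).symm ≫ₕ e' i ∘ (I i).symm) h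
    (contDiff_pi.1 contDiff_id i).contDiffOn ?_
  rintro x ⟨hx, y, rfl⟩
  exact ⟨⟨hx.1 i (Set.mem_univ i), hx.2 i (Set.mem_univ i)⟩, ⟨y i, rfl⟩⟩

theorem contMDiffAt_pi_iff {f : N → ∀ i, M i} {x : N} :
    ContMDiffAt J (ModelWithCorners.pi I) ∞ f x ↔
      ∀ i, ContMDiffAt J (I i) ∞ (fun y => f y i) x := by
  simp only [contMDiffAt_iff]
  rw [contDiffWithinAt_pi, continuousAt_pi, ← forall_and]
  rfl

theorem hasMFDerivAt_pi_iff {f : N → ∀ i, M i} {x : N}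
    {f' : ∀ i, TangentSpace J x →L[ℝ] TangentSpace (I i) (f x i)} :
    HasMFDerivAt J (ModelWithCorners.pi I) f x (ContinuousLinearMap.pi f') ↔
      ∀ i, HasMFDerivAt J (I i) (fun y => f y i) x (f' i) := by
  simp only [HasMFDerivAt, continuousAt_pi, forall_and]
  refine and_congr_right fun _ => ?_
  exact hasFDerivWithinAt_pi (F' := E)

theorem hasMFDerivAt_eval (x : ∀ i, M i) (i : ι) :
    HasMFDerivAt (ModelWithCorners.pi I) (I i) (fun y : ∀ i, M i => y i) x
      (ContinuousLinearMap.proj (R := ℝ) (φ := E) i) :=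
  hasMFDerivAt_pi_iff.1 (hasMFDerivAt_id (I := ModelWithCorners.pi I) x) i

theorem contMDiff_eval (i : ι) :
    ContMDiff (ModelWithCorners.pi I) (I i) ∞ (fun y : ∀ i, M i => y i) :=
  fun _ => contMDiffAt_pi_iff.1 contMDiffAt_id i

end PiManifold

/-! ### Manifolds with corners -/

/-- A (second countable, Hausdorff, smooth) manifold with corners. The model space is, up to a
linear isomorphism, a sector `{v : ℝⁿ | v j ≥ 0 for all j ∈ J}` of a Euclidean space. -/
structure Mfd : Type (u + 1) where
  carrier : Type u
  E : Type u
  H : Type u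
  [normedAddCommGroup : NormedAddCommGroup E]
  [normedSpace : NormedSpace ℝ E]
  [topH : TopologicalSpace H]
  I : ModelWithCorners ℝ E H
  corners : ∃ (ι : Type u) (_ : Finite ι) (L : E ≃ₗ[ℝ] (ι → ℝ)) (J : Set ι),
    Set.range I = {v | ∀ j ∈ J, 0 ≤ L v j}
  [top : TopologicalSpace carrier]
  [t2 : T2Space carrier]
  [secondCountable : SecondCountableTopology carrier]
  [charted : ChartedSpace H carrier]
  [isManifold : IsManifold I ∞ carrier]

instance : CoeSort Mfd.{u} (Type u) := ⟨Mfd.carrier⟩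

attribute [instance] Mfd.normedAddCommGroup Mfd.normedSpace Mfd.topH Mfd.top Mfd.t2
  Mfd.secondCountable Mfd.charted Mfd.isManifold

namespace Mfd

/-- The tangent bundle of a manifold with corners. -/
abbrev T (M : Mfd.{u}) : Type u := TangentBundle M.I M

/-- Smooth maps of manifolds with corners. -/
abbrev Smooth {M N : Mfd.{u}} (f : M → N) : Prop := ContMDiff M.I N.I ∞ f

/-- The product of a finite family of manifolds with corners. -/
def pi {X : Type u} [Fintype X] (M : X → Mfd.{u}) : Mfd.{u} where
  carrier := ∀ x, M x
  E := ∀ x, (M x).E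
  H := ModelPi fun x => (M x).H
  I := ModelWithCorners.pi fun x => (M x).I
  corners := by
    choose ι hι L J h using fun x => (M x).corners
    refine ⟨Σ x, ι x, inferInstance,
      (LinearEquiv.piCongrRight L).trans (LinearEquiv.piCurry ℝ fun x (_ : ι x) => ℝ).symm,
      {j | j.2 ∈ J j.1}, ?_⟩
    have h1 : Set.range (ModelWithCorners.pi fun x => (M x).I) =
        Set.univ.pi fun x => Set.range (M x).I := Set.range_piMap _
    rw [h1]
    ext v
    simp only [h, Set.mem_pi, Set.mem_univ, true_implies, Set.mem_ofPred_eq]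
    exact ⟨fun hv j hj => hv j.1 j.2 hj, fun hv x j hj => hv ⟨x, j⟩ hj⟩
  isManifold := isManifold_pi

end Mfd

/-! ### Hybrid phase spaces -/

/-- A hybrid phase space: a (strict) double functor from a small category `S`, regarded as a
discrete double category, to the double category of manifolds with corners, smooth maps and
relations. -/
structure HyPh : Type (u + 1) where
  S : Type u
  [cat : SmallCategory S]
  M : S → Mfd.{u}
  rel : ∀ {s t : S}, (s ⟶ t) → Set (M s × M t)
  rel_id : ∀ s : S, rel (𝟙 s) = {p | p.1 = p.2}
  rel_comp : ∀ {s t r : S} (γ : s ⟶ t) (δ : t ⟶ r),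
    rel (γ ≫ δ) = {p | ∃ y, (p.1, y) ∈ rel γ ∧ (y, p.2) ∈ rel δ}

attribute [instance] HyPh.cat

namespace HyPh

/-- A morphism of hybrid phase spaces. -/
@[ext]
structure Hom (a b : HyPh.{u}) where
  φ : a.S ⥤ b.S
  f : ∀ s, a.M s → b.M (φ.obj s)
  smooth : ∀ s, Mfd.Smooth (f s)
  map_rel : ∀ {s t : a.S} (γ : s ⟶ t) (p : a.M s × a.M t), p ∈ a.rel γ →
    (f s p.1, f t p.2) ∈ b.rel (φ.map γ)

instance : Category HyPh.{u} where
  Hom := Hom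
  id a :=
    { φ := 𝟭 a.S
      f := fun _ x => x
      smooth := fun _ => contMDiff_id
      map_rel := fun _ _ h => h }
  comp F G :=
    { φ := F.φ ⋙ G.φ
      f := fun s x => G.f (F.φ.obj s) (F.f s x)
      smooth := fun s => (G.smooth _).comp (F.smooth s)
      map_rel := fun γ p h => G.map_rel (F.φ.map γ) _ (F.map_rel γ p h) }

/-- The underlying manifold of a hybrid phase space. Its components `a(s)` may have different
dimensions. -/
abbrev U (a : HyPh.{u}) : Type u := Σ s : a.S, a.M s

/-- The tangent bundle of the underlying manifold. -/
abbrev TU (a : HyPh.{u}) : Type u := Σ s : a.S, (a.M s).T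

/-- The projection of the tangent bundle of the underlying manifold. -/
def τ {a : HyPh.{u}} (w : a.TU) : a.U := ⟨w.1, w.2.proj⟩

/-- The map of underlying manifolds given by a morphism of hybrid phase spaces. -/
def mapU {a b : HyPh.{u}} (F : a ⟶ b) (x : a.U) : b.U := ⟨F.φ.obj x.1, F.f x.1 x.2⟩

/-- The differential of `mapU F`. -/
def mapT {a b : HyPh.{u}} (F : a ⟶ b) (w : a.TU) : b.TU :=
  ⟨F.φ.obj w.1, tangentMap (a.M w.1).I (b.M (F.φ.obj w.1)).I (F.f w.1) w.2⟩

/-- Smoothness of a map from the underlying manifold of `a` to the tangent bundle of the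
underlying manifold of `b`: near each point it is a smooth map into one of the components. -/
def SmoothToT {a b : HyPh.{u}} (X : a.U → b.TU) : Prop :=
  ∀ (s : a.S) (x : a.M s), ∃ (t : b.S) (g : a.M s → (b.M t).T),
    ContMDiffAt (a.M s).I (b.M t).I.tangent ∞ g x ∧ ∀ᶠ y in 𝓝 x, X ⟨s, y⟩ = ⟨t, g y⟩

/-- The image of the canonical map `Λ` from the disjoint union of all relations `a(γ)` to
`U a × U a`: the pairs allowed as jumps. -/
def jumps (a : HyPh.{u}) : Set (a.U × a.U) :=
  {p | ∃ γ : p.1.1 ⟶ p.2.1, (p.1.2, p.2.2) ∈ a.rel γ}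

/-- The continuous-discrete bundle `TU a × U a`. -/
abbrev CD (a : HyPh.{u}) : Type u := a.TU × a.U

/-- The map of continuous-discrete bundles given by a morphism. -/
def mapCD {a b : HyPh.{u}} (F : a ⟶ b) (w : a.CD) : b.CD := (mapT F w.1, mapU F w.2)

/-- The product of a finite family of hybrid phase spaces. -/
def pi {X : Type u} [Fintype X] (A : X → HyPh.{u}) : HyPh.{u} where
  S := ∀ x, (A x).S
  cat := CategoryTheory.pi fun x => (A x).S
  M s := Mfd.pi fun x => (A x).M (s x)
  rel {s t} γ := {p | ∀ x, (p.1 x, p.2 x) ∈ (A x).rel ((γ : ∀ x, s x ⟶ t x) x)}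
  rel_id s := by
    ext p
    simp only [Pi.id_apply, rel_id, Set.mem_ofPred_eq]
    exact funext_iff.symm
  rel_comp γ δ := by
    ext p
    simp only [Pi.comp_apply, rel_comp, Set.mem_ofPred_eq]
    constructor
    · intro h
      choose y hy using h
      exact ⟨y, fun x => (hy x).1, fun x => (hy x).2⟩
    · rintro ⟨y, h1, h2⟩ x
      exact ⟨y x, h1 x, h2 x⟩

section Pi

variable {X : Type u} [Fintype X] (A : X → HyPh.{u})

/-- The projections of the product. -/
def proj (x : X) : pi A ⟶ A x where
  φ := Pi.eval (fun x => (A x).S) x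
  f _ y := y x
  smooth _ := contMDiff_eval x
  map_rel _ _ h := h x

variable {A}

/-- The morphism into the product induced by a family of morphisms. -/
def lift {c : HyPh.{u}} (F : ∀ x, c ⟶ A x) : c ⟶ pi A where
  φ := Functor.pi' fun x => (F x).φ
  f s y x := (F x).f s y
  smooth s y := (contMDiffAt_pi_iff (I := fun x => ((A x).M ((F x).φ.obj s)).I)
    (M := fun x => (A x).M ((F x).φ.obj s)) (f := fun y x => (F x).f s y)).2
    fun x => (F x).smooth s y
  map_rel γ p h x := (F x).map_rel γ p h

theorem lift_proj {c : HyPh.{u}} (F : ∀ x, c ⟶ A x) (x : X) : lift F ≫ proj A x = F x := rfl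

theorem lift_unique {c : HyPh.{u}} (F : ∀ x, c ⟶ A x) (G : c ⟶ pi A)
    (h : ∀ x, G ≫ proj A x = F x) : G = lift F := by
  obtain rfl : F = fun x => G ≫ proj A x := funext fun x => (h x).symm
  rfl

variable (A)

/-- The canonical isomorphism `U (∏ A x) ≅ ∏ U (A x)`. -/
def piU : (pi A).U ≃ ∀ x, (A x).U where
  toFun z x := mapU (proj A x) z
  invFun z := ⟨fun x => (z x).1, fun x => (z x).2⟩
  left_inv _ := rfl
  right_inv _ := rfl

theorem mapT_proj (x : X) (w : (pi A).TU) :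
    mapT (proj A x) w = ⟨w.1 x, ⟨w.2.1 x, w.2.2 x⟩⟩ := by
  have h := (hasMFDerivAt_eval (I := fun x => ((A x).M (w.1 x)).I) w.2.1 x).mfderiv
  exact congrArg (fun L => (⟨w.1 x, ⟨w.2.1 x, L w.2.2⟩⟩ : (A x).TU)) h

/-- The canonical isomorphism `TU (∏ A x) ≅ ∏ TU (A x)`. -/
def piT : (pi A).TU ≃ ∀ x, (A x).TU where
  toFun w x := mapT (proj A x) w
  invFun w := ⟨fun x => (w x).1, ⟨fun x => (w x).2.1, fun x => (w x).2.2⟩⟩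
  left_inv _ := congrArg
    (fun v : ∀ x, (A x).TU =>
      (⟨fun x => (v x).1, ⟨fun x => (v x).2.1, fun x => (v x).2.2⟩⟩ : (pi A).TU))
    (funext fun x => mapT_proj A x _)
  right_inv w := funext fun x => mapT_proj A x _

end Pi

end HyPh

/-! ### Hybrid surjective submersions -/

/-- A hybrid surjective submersion. -/
structure HySSub : Type (u + 1) where
  tot : HyPh.{u}
  st : HyPh.{u}
  p : tot ⟶ st
  surj : Function.Surjective (HyPh.mapU p)
  submersion : ∀ (s : tot.S) (x : tot.M s),
    Function.Surjective (mfderiv (tot.M s).I (st.M (p.φ.obj s)).I (p.f s) x)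

namespace HySSub

/-- A morphism of hybrid surjective submersions. -/
@[ext]
structure Hom (a b : HySSub.{u}) where
  tot : a.tot ⟶ b.tot
  st : a.st ⟶ b.st
  comm : a.p ≫ st = tot ≫ b.p

instance : Category HySSub.{u} where
  Hom := Hom
  id a := { tot := 𝟙 a.tot, st := 𝟙 a.st, comm := by simp }
  comp F G :=
    { tot := F.tot ≫ G.tot
      st := F.st ≫ G.st
      comm := by rw [← Category.assoc, F.comm, Category.assoc, G.comm, Category.assoc] }

/-- The product of a finite family of hybrid surjective submersions. -/
def pi {X : Type u} [Fintype X] (A : X → HySSub.{u}) : HySSub.{u} where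
  tot := HyPh.pi fun x => (A x).tot
  st := HyPh.pi fun x => (A x).st
  p := HyPh.lift fun x => HyPh.proj (fun x => (A x).tot) x ≫ (A x).p
  surj y := by
    choose x hx using fun i => (A i).surj ((HyPh.piU fun i => (A i).st) y i)
    refine ⟨(HyPh.piU fun i => (A i).tot).symm x, ?_⟩
    exact (HyPh.piU fun i => (A i).st).injective (funext hx)
  submersion s x w := by
    choose v hv using fun i => (A i).submersion (s i) (x i) (w i)
    let y : ∀ i, (A i).tot.M (s i) := x
    have h := (hasMFDerivAt_pi_iff (N := ∀ i, (A i).tot.M (s i))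
      (f := fun y i => (A i).p.f (s i) (y i))).2 fun i =>
      (((A i).p.smooth (s i) (y i)).mdifferentiableAt (by simp)).hasMFDerivAt.comp y
        (hasMFDerivAt_eval (I := fun i => ((A i).tot.M (s i)).I) y i)
    refine ⟨v, ?_⟩
    exact (congrArg (fun L => L v) h.mfderiv).trans (funext hv)

/-- The projections of the product. -/
def proj {X : Type u} [Fintype X] (A : X → HySSub.{u}) (x : X) : pi A ⟶ A x where
  tot := HyPh.proj (fun x => (A x).tot) x
  st := HyPh.proj (fun x => (A x).st) x
  comm := rfl

/-- The morphism into the product induced by a family of morphisms. -/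
def lift {X : Type u} [Fintype X] {A : X → HySSub.{u}} {c : HySSub.{u}} (F : ∀ x, c ⟶ A x) :
    c ⟶ pi A where
  tot := HyPh.lift fun x => (F x).tot
  st := HyPh.lift fun x => (F x).st
  comm := by
    have h1 := HyPh.lift_unique (fun x => c.p ≫ (F x).st)
      (c.p ≫ HyPh.lift fun x => (F x).st) fun x => rfl
    have h2 := HyPh.lift_unique (fun x => c.p ≫ (F x).st)
      ((HyPh.lift fun x => (F x).tot) ≫ HyPh.lift fun x => HyPh.proj _ x ≫ (A x).p)
      fun x => (F x).comm.symm
    exact h1.trans h2.symm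

theorem lift_proj {X : Type u} [Fintype X] {A : X → HySSub.{u}} {c : HySSub.{u}}
    (F : ∀ x, c ⟶ A x) (x : X) : lift F ≫ proj A x = F x := rfl

theorem lift_unique {X : Type u} [Fintype X] {A : X → HySSub.{u}} {c : HySSub.{u}}
    (F : ∀ x, c ⟶ A x) (G : c ⟶ pi A) (h : ∀ x, G ≫ proj A x = F x) : G = lift F := by
  obtain rfl : F = fun x => G ≫ proj A x := funext fun x => (h x).symm
  rfl

/-- The morphism `Π(φ, Φ)` between products induced by a map `φ` of index sets and a family of
morphisms `Φ x : B (φ x) ⟶ A x`. -/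
def piMap {X Y : Type u} [Fintype X] [Fintype Y] {A : X → HySSub.{u}} {B : Y → HySSub.{u}}
    (φ : X → Y) (Φ : ∀ x, B (φ x) ⟶ A x) : pi B ⟶ pi A :=
  lift fun x => proj B (φ x) ≫ Φ x

/-- An interconnection: a morphism that is an isomorphism on state spaces. -/
def IsInterconnection {a b : HySSub.{u}} (i : a ⟶ b) : Prop := IsIso i.st

end HySSub

/-! ### Deterministic control -/

open HyPh HySSub

/-- Deterministic controls on `a`: maps `(X, ρ) : U a_tot → TU a_st × U a_st` with `X` smooth,
`τ ∘ X = U p`, and such that each jump from `U p x` to `ρ x` is allowed by some edge of `a_st`. -/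
def dCrl (a : HySSub.{u}) : Set (a.tot.U → a.st.CD) :=
  {c | SmoothToT (fun x => (c x).1) ∧ (∀ x, τ (c x).1 = mapU a.p x) ∧
    ∀ x, (mapU a.p x, (c x).2) ∈ a.st.jumps}

/-- `(X, ρ)` and `(Y, σ)` are `f`-related. -/
def Related {a b : HySSub.{u}} (f : a ⟶ b) (c : a.tot.U → a.st.CD) (d : b.tot.U → b.st.CD) :
    Prop :=
  (∀ x, mapT f.st (c x).1 = (d (mapU f.tot x)).1) ∧
    ∀ x, mapU f.st (c x).2 = (d (mapU f.tot x)).2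

/-- The relation `dCrl(f)` between deterministic controls on `a` and on `b`. -/
def dCrlRel {a b : HySSub.{u}} (f : a ⟶ b) : Set (dCrl a × dCrl b) :=
  {p | Related f p.1 p.2}

/-- The pullback `(TU i_st⁻¹ ∘ Y ∘ U i_tot, U i_st⁻¹ ∘ σ ∘ U i_tot)` of `(Y, σ)` along an
interconnection `i`. -/
def dCrlPullback {a b : HySSub.{u}} (i : a ⟶ b) (hi : IsInterconnection i)
    (d : b.tot.U → b.st.CD) (x : a.tot.U) : a.st.CD :=
  haveI : IsIso i.st := hi
  mapCD (inv i.st) (d (mapU i.tot x))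

/-- The product of a family of maps `(X_x, ρ_x) : U (A x)_tot → TU (A x)_st × U (A x)_st`, as a
map on the product of the `A x`. -/
def prodControl {X : Type u} [Fintype X] (A : X → HySSub.{u})
    (v : ∀ x, (A x).tot.U → (A x).st.CD) (z : (HySSub.pi A).tot.U) : (HySSub.pi A).st.CD :=
  ((piT fun x => (A x).st).symm fun x => (v x (piU (fun x => (A x).tot) z x)).1,
    (piU fun x => (A x).st).symm fun x => (v x (piU (fun x => (A x).tot) z x)).2)

/-! ### Networks -/

/-- A network of hybrid open systems, indexed by a finite set `X`. -/
structure Network (X : Type u) [Fintype X] where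
  H : X → HySSub.{u}
  a : HySSub.{u}
  i : a ⟶ HySSub.pi H
  isInterconnection : IsInterconnection i

/-- A morphism of networks of hybrid open systems. -/
structure NetworkHom {X Y : Type u} [Fintype X] [Fintype Y] (NX : Network X) (NY : Network Y) where
  φ : X → Y
  Φ : ∀ x, NY.H (φ x) ⟶ NX.H x
  z : NY.a ⟶ NX.a
  comm : NY.i ≫ piMap φ Φ = z ≫ NX.i

/-- The relation `dCrl(φ, Φ)` between products of sets of deterministic controls. -/
def dCrlListRel {X Y : Type u} [Fintype X] [Fintype Y] {NX : Network X} {NY : Network Y}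
    (m : NetworkHom NX NY) : Set ((∀ y, dCrl (NY.H y)) × (∀ x, dCrl (NX.H x))) :=
  {p | ∀ x, (p.1 (m.φ x), p.2 x) ∈ dCrlRel (m.Φ x)}

/-- The functions `f`, `g` and the relations `R`, `S` form a 1-morphism (a square) in the double
category of sets, functions and relations: `(f × g)(R) ⊆ S`. -/
def IsOneMorphism {A B C D : Type u} (R : Set (A × B)) (S : Set (C × D)) (f : A → C)
    (g : B → D) : Prop :=
  Prod.map f g '' R ⊆ S

end

/-! ### Smooth maps into the tangent bundle of a product -/

/-! Relatedness is a pair of equations between maps, and both constructions respect it. For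
products, a point of `TU` or `U` of a product is determined by its projections, and the
`x`-component of `Π(φ, Φ)` is `Φ x` after the projection to `φ x`; so the equations for `Π(φ, Φ)`
are those for the individual `Φ x` (`related_prodControl`). For pullbacks, the network square
inverted on state spaces gives `inv j.st ≫ z.st = f.st ≫ inv i.st`, which carries `f`-relatedness to
`z`-relatedness (`related_dCrlPullback`).

That the maps land in `dCrl` needs the chain rule, functoriality of jumps, and one analytic fact: a
tuple of smooth maps into tangent bundles is smooth into the tangent bundle of the product
(`contMDiffAt_tangentBundle_pi`). -/

namespace Mfd

variable {X : Type u} [Fintype X] (M : X → Mfd.{u})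

/-- Transition maps of product charts are products of transition maps, so their derivative is block
diagonal. -/
theorem tangentCoordChange_pi (p q : Mfd.pi M)
    (h : ∀ i, p i ∈ (extChartAt (M i).I (q i)).source) (v : ∀ i, (M i).E) :
    tangentCoordChange (Mfd.pi M).I p q p v =
      (fun i => tangentCoordChange (M i).I (p i) (q i) (p i) (v i) : ∀ i, (M i).E) := by
  have hsource : p ∈ (extChartAt (Mfd.pi M).I q).source := by
    rw [extChartAt_source]
    intro i _
    have := h i
    rwa [extChartAt_source] at this
  have h1 := hasFDerivWithinAt_tangentCoordChange (I := (Mfd.pi M).I)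
    ⟨mem_extChartAt_source p, hsource⟩
  have h2 : HasFDerivWithinAt
      (extChartAt (Mfd.pi M).I q ∘ (extChartAt (Mfd.pi M).I p).symm)
      (ContinuousLinearMap.pi fun i =>
        (tangentCoordChange (M i).I (p i) (q i) (p i)).comp
          (ContinuousLinearMap.proj (R := ℝ) (φ := fun i => (M i).E) i))
      (Set.range (Mfd.pi M).I) (extChartAt (Mfd.pi M).I p p) := by
    refine hasFDerivWithinAt_pi (F' := fun i => (M i).E) |>.2 fun i => ?_
    refine HasFDerivWithinAt.comp (t := Set.range (M i).I)
      (g := extChartAt (M i).I (q i) ∘ (extChartAt (M i).I (p i)).symm)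
      (f := fun y : ∀ i, (M i).E => y i) _
      (hasFDerivWithinAt_tangentCoordChange ⟨mem_extChartAt_source (p i), h i⟩)
      (ContinuousLinearMap.proj (R := ℝ) (φ := fun i => (M i).E) i).hasFDerivWithinAt ?_
    rintro _ ⟨y, rfl⟩
    exact ⟨y i, rfl⟩
  -- With corners, these are derivatives only within the range of the model; unique
  -- differentiability there forces the two to agree.
  have huniq : UniqueDiffWithinAt ℝ (Set.range (Mfd.pi M).I) (extChartAt (Mfd.pi M).I p p) :=
    (Mfd.pi M).I.uniqueDiffWithinAt_image
  exact congrArg (fun L : (Mfd.pi M).E →L[ℝ] (Mfd.pi M).E => L v) (huniq.eq h1 h2)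

variable {M}

/-- Smoothness into a bundle is tested on the base point and on the fibre coordinate in the
trivialization at the image of `x`. For the product, that fibre coordinate is the tuple of the
individual ones. -/
theorem contMDiffAt_tangentBundle_pi {N : Mfd.{u}} {g : ∀ i, N → (M i).T} {x : N}
    (h : ∀ i, ContMDiffAt N.I (M i).I.tangent ∞ (g i) x) :
    ContMDiffAt N.I (Mfd.pi M).I.tangent ∞
      (fun y => (⟨fun i => (g i y).1, fun i => (g i y).2⟩ : (Mfd.pi M).T)) x := by
  have h' := fun i => Bundle.contMDiffAt_totalSpace.1 (h i)
  refine Bundle.contMDiffAt_totalSpace.2 ⟨?_, ?_⟩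
  · exact (contMDiffAt_pi_iff (I := fun i => (M i).I)).2 fun i => (h' i).1
  · have h2 : ContMDiffAt N.I 𝓘(ℝ, ∀ i, (M i).E) ∞ (fun y i =>
        (trivializationAt (M i).E (TangentSpace (M i).I) (g i x).1 (g i y)).2) x :=
      contMDiffAt_pi_space.2 fun i => (h' i).2
    refine h2.congr_of_eventuallyEq ?_
    -- The fibre coordinates are compared only while every base point stays in its chart domain;
    -- finiteness of the index set makes this a neighbourhood of `x`.
    have hs : ∀ i, ∀ᶠ y in 𝓝 x, (g i y).1 ∈ (extChartAt (M i).I (g i x).1).source := fun i =>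
      (h' i).1.continuousAt.eventually (extChartAt_source_mem_nhds (I := (M i).I) (g i x).1)
    filter_upwards [Filter.eventually_all.2 hs] with y hy
    -- The fibre coordinate in a tangent trivialization is by definition the coordinate change from
    -- the point's own preferred chart.
    exact tangentCoordChange_pi M (fun i => (g i y).1) (fun i => (g i x).1) hy
      fun i => (g i y).2

end Mfd

namespace HyPh

/-! ### Functoriality of the differential and of jumps -/

theorem mapT_comp {a b c : HyPh.{u}} (F : a ⟶ b) (G : b ⟶ c) (w : a.TU) :
    mapT (F ≫ G) w = mapT G (mapT F w) := by
  have h := tangentMap_comp_at w.2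
    (((G.smooth (F.φ.obj w.1)) (F.f w.1 w.2.1)).mdifferentiableAt (by simp))
    ((F.smooth w.1 w.2.1).mdifferentiableAt (by simp))
  exact congrArg (fun v => (⟨G.φ.obj (F.φ.obj w.1), v⟩ : c.TU)) h

theorem mapU_comp {a b c : HyPh.{u}} (F : a ⟶ b) (G : b ⟶ c) (x : a.U) :
    mapU (F ≫ G) x = mapU G (mapU F x) := rfl

theorem mapU_mem_jumps {a b : HyPh.{u}} (F : a ⟶ b) {x y : a.U} (h : (x, y) ∈ a.jumps) :
    (mapU F x, mapU F y) ∈ b.jumps :=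
  let ⟨γ, hγ⟩ := h
  ⟨F.φ.map γ, F.map_rel γ _ hγ⟩

theorem mapU_inv_hom {a b : HyPh.{u}} (F : a ⟶ b) [IsIso F] (x : a.U) :
    mapU (inv F) (mapU F x) = x := by
  -- Cancelling between morphisms, before evaluating, avoids transport along the equality of
  -- functors on objects.
  rw [← mapU_comp, IsIso.hom_inv_id]
  rfl

/-! ### Smooth maps into tangent bundles of hybrid phase spaces -/

theorem SmoothToT.comp_mapU {a b c : HyPh.{u}} {V : b.U → c.TU} (hV : SmoothToT V)
    (F : a ⟶ b) : SmoothToT fun x => V (mapU F x) := by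
  intro s x
  obtain ⟨t, g, hg, he⟩ := hV (F.φ.obj s) (F.f s x)
  exact ⟨t, fun y => g (F.f s y), hg.comp x (F.smooth s x),
    (F.smooth s).continuous.continuousAt.eventually he⟩

theorem SmoothToT.mapT_comp {a b c : HyPh.{u}} {V : a.U → b.TU} (hV : SmoothToT V)
    (F : b ⟶ c) : SmoothToT fun x => mapT F (V x) := by
  intro s x
  obtain ⟨t, g, hg, he⟩ := hV s x
  refine ⟨F.φ.obj t, fun y => tangentMap (b.M t).I (c.M (F.φ.obj t)).I (F.f t) (g y), ?_, ?_⟩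
  · exact (((F.smooth t).contMDiff_tangentMap (m := ∞) le_rfl) (g x)).comp x hg
  · filter_upwards [he] with y hy
    rw [hy]
    rfl

theorem SmoothToT.piT_symm {X : Type u} [Fintype X] {a : HyPh.{u}} {A : X → HyPh.{u}}
    {V : ∀ i, a.U → (A i).TU} (hV : ∀ i, SmoothToT (V i)) :
    SmoothToT fun x => (piT A).symm fun i => V i x := by
  intro s x
  choose t g hg he using fun i => hV i s x
  refine ⟨t, fun y => ⟨fun i => (g i y).1, fun i => (g i y).2⟩,
    Mfd.contMDiffAt_tangentBundle_pi (M := fun i => (A i).M (t i)) hg, ?_⟩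
  filter_upwards [Filter.eventually_all.2 he] with y hy
  rw [funext hy]
  rfl

theorem mapT_proj_piT_symm {X : Type u} [Fintype X] (A : X → HyPh.{u}) (w : ∀ i, (A i).TU)
    (i : X) : mapT (proj A i) ((piT A).symm w) = w i :=
  congrFun ((piT A).apply_symm_apply w) i

end HyPh

/-! ### Products and pullbacks of deterministic controls -/

open HyPh HySSub

theorem prodControl_mem {X : Type u} [Fintype X] (A : X → HySSub.{u})
    (v : ∀ x, dCrl (A x)) : prodControl A (fun x => v x) ∈ dCrl (HySSub.pi A) := by
  refine ⟨?_, fun z => ?_, fun z => ?_⟩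
  · exact SmoothToT.piT_symm fun i => (v i).2.1.comp_mapU (proj (fun x => (A x).tot) i)
  · exact (piU fun x => (A x).st).injective
      (funext fun i => (v i).2.2.1 (mapU (HyPh.proj (fun x => (A x).tot) i) z))
  · choose γ hγ using fun i => (v i).2.2.2 (mapU (HyPh.proj (fun x => (A x).tot) i) z)
    exact ⟨γ, hγ⟩

theorem dCrlPullback_mem {a b : HySSub.{u}} (i : a ⟶ b) (hi : IsInterconnection i)
    {d : b.tot.U → b.st.CD} (hd : d ∈ dCrl b) : dCrlPullback i hi d ∈ dCrl a := by
  have : IsIso i.st := hi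
  -- The square of `i` over the submersions, with `i.st` cancelled. It reduces both the section
  -- condition and the jump condition for the pullback to those for `d`.
  have hp : ∀ x, mapU (inv i.st) (mapU b.p (mapU i.tot x)) = mapU a.p x := fun x => by
    rw [← mapU_comp i.tot, ← i.comm, mapU_comp, mapU_inv_hom]
  refine ⟨(hd.1.comp_mapU i.tot).mapT_comp (inv i.st), fun x => ?_, fun x => ?_⟩
  · rw [← hp, ← hd.2.1]
    rfl
  · rw [← hp]
    exact mapU_mem_jumps (inv i.st) (hd.2.2 (mapU i.tot x))

theorem related_prodControl {X Y : Type u} [Fintype X] [Fintype Y] {A : X → HySSub.{u}}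
    {B : Y → HySSub.{u}} (φ : X → Y) (Φ : ∀ x, B (φ x) ⟶ A x)
    {w : ∀ y, (B y).tot.U → (B y).st.CD} {v : ∀ x, (A x).tot.U → (A x).st.CD}
    (h : ∀ x, Related (Φ x) (w (φ x)) (v x)) :
    Related (piMap φ Φ) (prodControl B w) (prodControl A v) := by
  refine ⟨fun z => ?_, fun z => ?_⟩
  · refine (piT fun x => (A x).st).injective (funext fun x => ?_)
    calc mapT (HyPh.proj (fun x => (A x).st) x) (mapT (piMap φ Φ).st (prodControl B w z).1)
        -- Both sides are the differential of one composite, since `lift ≫ proj` reduces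
        -- definitionally; the chain rule is applied once in each direction.
        = mapT (Φ x).st (mapT (HyPh.proj (fun y => (B y).st) (φ x)) (prodControl B w z).1) :=
          (mapT_comp (piMap φ Φ).st (HyPh.proj (fun x => (A x).st) x) _).symm.trans
            (mapT_comp (HyPh.proj (fun y => (B y).st) (φ x)) (Φ x).st _)
      _ = mapT (Φ x).st (w (φ x) (mapU (HyPh.proj (fun y => (B y).tot) (φ x)) z)).1 :=
          congrArg _ (mapT_proj_piT_symm _ _ _)
      _ = (v x (mapU (HyPh.proj (fun x => (A x).tot) x) (mapU (piMap φ Φ).tot z))).1 :=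
          (h x).1 _
      _ = _ := (mapT_proj_piT_symm (fun x => (A x).st) (fun x =>
          (v x (mapU (HyPh.proj (fun x => (A x).tot) x) (mapU (piMap φ Φ).tot z))).1) x).symm
  · exact (piU fun x => (A x).st).injective (funext fun x => (h x).2 _)

/-- On the continuous part, `Tz ∘ Tj⁻¹ ∘ d ∘ j = Ti⁻¹ ∘ Tf ∘ d ∘ j = Ti⁻¹ ∘ c ∘ f ∘ j = Ti⁻¹ ∘ c ∘ i
∘ z`, with differentials taken on state spaces and the other morphisms on total spaces. The discrete
part is the same with `U` for `T`. -/
theorem related_dCrlPullback {a b a' b' : HySSub.{u}} {i : a ⟶ a'} (hi : IsInterconnection i)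
    {j : b ⟶ b'} (hj : IsInterconnection j) {z : b ⟶ a} {f : b' ⟶ a'}
    (comm : j ≫ f = z ≫ i) {d : b'.tot.U → b'.st.CD} {c : a'.tot.U → a'.st.CD}
    (h : Related f d c) : Related z (dCrlPullback j hj d) (dCrlPullback i hi c) := by
  have : IsIso i.st := hi
  have : IsIso j.st := hj
  have hst : j.st ≫ f.st = z.st ≫ i.st := congrArg HySSub.Hom.st comm
  have htot : j.tot ≫ f.tot = z.tot ≫ i.tot := congrArg HySSub.Hom.tot comm
  have hinv : inv j.st ≫ z.st = f.st ≫ inv i.st := by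
    rw [IsIso.inv_comp_eq, ← Category.assoc, hst, Category.assoc, IsIso.hom_inv_id,
      Category.comp_id]
  have hU : ∀ x, mapU f.tot (mapU j.tot x) = mapU i.tot (mapU z.tot x) := fun x =>
    congrArg (fun F => mapU F x) htot
  refine ⟨fun x => ?_, fun x => ?_⟩
  · change mapT z.st (mapT (inv j.st) (d (mapU j.tot x)).1) =
      mapT (inv i.st) (c (mapU i.tot (mapU z.tot x))).1
    rw [← mapT_comp, hinv, mapT_comp, h.1, hU]
  · change mapU z.st (mapU (inv j.st) (d (mapU j.tot x)).2) =
      mapU (inv i.st) (c (mapU i.tot (mapU z.tot x))).2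
    rw [← mapU_comp, hinv, mapU_comp, h.2, hU]

theorem mainTheorem2 {X Y : Type u} [Fintype X] [Fintype Y] (NX : Network X) (NY : Network Y)
    (m : NetworkHom NX NY) :
    ∃ (PX : (∀ x, dCrl (NX.H x)) → dCrl (HySSub.pi NX.H))
      (PY : (∀ y, dCrl (NY.H y)) → dCrl (HySSub.pi NY.H))
      (IX : dCrl (HySSub.pi NX.H) → dCrl NX.a)
      (IY : dCrl (HySSub.pi NY.H) → dCrl NY.a),
      (∀ v, (PX v : _ → _) = prodControl NX.H fun x => v x) ∧
      (∀ w, (PY w : _ → _) = prodControl NY.H fun y => w y) ∧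
      (∀ c, (IX c : _ → _) = dCrlPullback NX.i NX.isInterconnection c) ∧
      (∀ d, (IY d : _ → _) = dCrlPullback NY.i NY.isInterconnection d) ∧
      IsOneMorphism (dCrlListRel m) (dCrlRel m.z) (IY ∘ PY) (IX ∘ PX) ∧
      ∀ (w : ∀ y, dCrl (NY.H y)) (v : ∀ x, dCrl (NX.H x)),
        (∀ x, Related (m.Φ x) (w (m.φ x)).1 (v x).1) →
          Related m.z (IY (PY w)).1 (IX (PX v)).1 := by
  -- Stated for the underlying functions, this yields both the square in relations and its
  -- elementwise form.
  have key : ∀ (w : ∀ y, dCrl (NY.H y)) (v : ∀ x, dCrl (NX.H x)),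
      (∀ x, Related (m.Φ x) (w (m.φ x)).1 (v x).1) →
        Related m.z (dCrlPullback NY.i NY.isInterconnection (prodControl NY.H fun y => w y))
          (dCrlPullback NX.i NX.isInterconnection (prodControl NX.H fun x => v x)) := fun w v h =>
    related_dCrlPullback NX.isInterconnection NY.isInterconnection m.comm
      (related_prodControl m.φ m.Φ h)
  refine ⟨fun v => ⟨_, prodControl_mem NX.H v⟩, fun w => ⟨_, prodControl_mem NY.H w⟩,
    fun c => ⟨_, dCrlPullback_mem NX.i NX.isInterconnection c.2⟩,
    fun d => ⟨_, dCrlPullback_mem NY.i NY.isInterconnection d.2⟩,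
    fun _ => rfl, fun _ => rfl, fun _ => rfl, fun _ => rfl, ?_, key⟩
  rintro _ ⟨⟨w, v⟩, h, rfl⟩
  exact key w v h
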